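/- Proposition (modular function via structure constants). Let $G$ be a connected $n$-dimensional (real, smooth, Hausdorff, second countable) Lie group with identity $e$, Lie algebra $\mathfrak g = T_eG$ (with the bracket of left-invariant vector fields) and exponential map $\exp:\mathfrak g\to G$. Let $\lambda:G\to\mathbb R_{>0}$ be its modular function, i.e. $\mu(Ag)=\lambda(g)\,\mu(A)$ for every left Haar measure $\mu$ on $G$, every $g\in G$ and every Borel set $A\subseteq G$. Let $\langle\cdot,\cdot\rangle_{\mathfrak g}$ be an inner product on $\mathfrak g$, let $\{\mathbf e_1,\dots,\mathbf e_n\}$ be an orthonormal basis of $\mathfrak g$, and let $c_{ij}^k\in\mathbb R$ be the structure constants, $[\mathbf e_i,\mathbf e_j]=\sum_{k=1}^n c_{ij}^k\,\mathbf e_k$. Put $$\mathbf a=\Bigl(\sum_{j=1}^n c_{1j}^j,\ \dots,\ \sum_{j=1}^n c_{nj}^j\Bigr)^{\top}\in\mathbb R^n .$$ Let $m\ge 1$, let $\mathbf v_1,\dots,\mathbf v_{m-1}\in\mathfrak g$ be arbitrary, put $\mathbf b_i=\bigl(\langle\mathbf e_1,\mathbf v_i\rangle_{\mathfrak g},\dots,\langle\mathbf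 e_n,\mathbf v_i\rangle_{\mathfrak g}\bigr)^{\top}\in\mathbb R^n$ for $1\le i\le m-1$, and let $\hat w_m=\exp(\mathbf v_1)\exp(\mathbf v_2)\cdots\exp(\mathbf v_{m-1})$ (the empty product is $e$). Then $$\lambda(\hat w_m)=\exp\Bigl(-\sum_{i=1}^{m-1}\mathbf a^{\top}\mathbf b_i\Bigr).$$ -/

import Mathlib

open MeasureTheory
open scoped Manifold ContDiff

noncomputable section

section LieExp

variable {E : Type*} [NormedAddCommGroup E] [NormedSpace ℝ E] {H : Type*} [TopologicalSpace H]
  {I : ModelWithCorners ℝ E H} {G : Type*} [TopologicalSpace G] [ChartedSpace H G] [Group G]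

open Classical in
/-- The exponential map of a Lie group: `lieExp v = γ 1`, where `γ` is the global integral curve,
starting at the identity, of the left-invariant vector field generated by `v`. This curve exists
and is unique, see `exists_integralCurve_mulInvariantVectorField` and `lieExp_eq`. -/
def lieExp (v : GroupLieAlgebra I G) : G :=
  if h : ∃ γ : ℝ → G, γ 0 = 1 ∧ IsMIntegralCurve γ (mulInvariantVectorField v)
  then h.choose 1 else 1

theorem mfderiv_mul_left_mulInvariantVectorField [LieGroup I ∞ G]
    (v : GroupLieAlgebra I G) (x y : G) :
    mfderiv I I (x * ·) y (mulInvariantVectorField v y) = mulInvariantVectorField v (x * y) := by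
  have h : (fun z : G => x * y * z) = (fun z => x * z) ∘ (fun z => y * z) := by
    ext z; simp [mul_assoc]
  have hd : ∀ a b : G, MDifferentiableAt I I (fun z : G => a * z) b := fun a b =>
    (contMDiff_mul_left (I := I) (n := ∞) (a := a)).contMDiffAt.mdifferentiableAt (by simp)
  have h1 : ∀ z, z = y → HasMFDerivAt I I (fun z : G => x * z) z
      (mfderiv I I (fun z : G => x * z) y : E →L[ℝ] E) := by
    rintro _ rfl; exact (hd x _).hasMFDerivAt
  have h2 := (h1 (y * 1) (mul_one y)).comp 1 (hd y 1).hasMFDerivAt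
  rw [← h] at h2
  exact (congrArg (fun L : E →L[ℝ] E => L v) h2.mfderiv).symm

theorem contMDiff_one_mulInvariantVectorField [LieGroup I ∞ G] (v : GroupLieAlgebra I G) :
    ContMDiff I I.tangent 1
      (fun g : G => (⟨g, mulInvariantVectorField v g⟩ : TangentBundle I G)) := by
  have : LieGroup I (minSmoothness ℝ 3) G :=
    LieGroup.of_le (n := ∞) (by simp only [minSmoothness_of_isRCLikeNormedField]; exact ENat.LEInfty.out)
  refine (contMDiff_mulInvariantVectorField v).of_le ?_
  simp

/-- Left-invariant vector fields are complete. -/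
theorem exists_integralCurve_mulInvariantVectorField [FiniteDimensional ℝ E] [I.Boundaryless]
    [T2Space G] [LieGroup I ∞ G] (v : GroupLieAlgebra I G) :
    ∃ γ : ℝ → G, γ 0 = 1 ∧ IsMIntegralCurve γ (mulInvariantVectorField v) := by
  have : CompleteSpace E := FiniteDimensional.complete ℝ E
  have : IsManifold I 1 G := IsManifold.of_le (n := ∞) (by simp)
  have hv := contMDiff_one_mulInvariantVectorField (I := I) (G := G) v
  obtain ⟨γ, h0, hγ⟩ := exists_isMIntegralCurveAt_of_contMDiffAt_boundaryless (I := I) 0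
    (hv.contMDiffAt (x := (1 : G)))
  rw [isMIntegralCurveAt_iff'] at hγ
  obtain ⟨ε, hε, hγ⟩ := hγ
  refine exists_isMIntegralCurve_of_isMIntegralCurveOn hv hε (fun x => ?_) 1
  refine ⟨fun t => x * γ t, by simp [h0], ?_⟩
  intro t ht
  have ht' : t ∈ Metric.ball (0 : ℝ) ε := by
    simpa [Real.ball_eq_Ioo] using ht
  have h1 : HasMFDerivAt 𝓘(ℝ, ℝ) I γ t _ :=
    (hγ t ht').hasMFDerivAt (Metric.isOpen_ball.mem_nhds ht')
  have h2 : HasMFDerivAt I I (fun z : G => x * z) (γ t) (mfderiv I I (fun z : G => x * z) (γ t)) :=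
    ((contMDiff_mul_left (I := I) (n := ∞) (a := x)).contMDiffAt.mdifferentiableAt
      (by simp)).hasMFDerivAt
  have h3 := h2.comp t h1
  refine HasMFDerivAt.hasMFDerivWithinAt ?_
  have h4 : (ContinuousLinearMap.smulRight (1 : ℝ →L[ℝ] ℝ)
      (mulInvariantVectorField (I := I) v (x * γ t)) : ℝ →L[ℝ] E) =
      (mfderiv I I (fun z : G => x * z) (γ t)).comp
        (ContinuousLinearMap.smulRight (1 : ℝ →L[ℝ] ℝ) (mulInvariantVectorField v (γ t))) := by
    rw [← mfderiv_mul_left_mulInvariantVectorField]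
    refine ContinuousLinearMap.ext fun r => ?_
    exact (map_smul (mfderiv I I (fun z : G => x * z) (γ t)) r
      (mulInvariantVectorField v (γ t))).symm
  exact h4 ▸ h3

/-- `lieExp v` is the value at time `1` of the integral curve through the identity. -/
theorem lieExp_eq [FiniteDimensional ℝ E] [I.Boundaryless]
    [T2Space G] [LieGroup I ∞ G] (v : GroupLieAlgebra I G) {γ : ℝ → G} (h0 : γ 0 = 1)
    (hγ : IsMIntegralCurve γ (mulInvariantVectorField v)) : lieExp v = γ 1 := by
  have : CompleteSpace E := FiniteDimensional.complete ℝ E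
  have : IsManifold I 1 G := IsManifold.of_le (n := ∞) (by simp)
  have h : ∃ γ : ℝ → G, γ 0 = 1 ∧ IsMIntegralCurve γ (mulInvariantVectorField v) := ⟨γ, h0, hγ⟩
  rw [lieExp, dif_pos h]
  have := isMIntegralCurve_Ioo_eq_of_contMDiff_boundaryless (I := I) (t₀ := 0)
    (contMDiff_one_mulInvariantVectorField v) h.choose_spec.2 hγ (h.choose_spec.1.trans h0.symm)
  rw [this]

end LieExp

section Modular

variable {E : Type*} [NormedAddCommGroup E] [NormedSpace ℝ E] {H : Type*} [TopologicalSpace H]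
  (I : ModelWithCorners ℝ E H) {G : Type*} [TopologicalSpace G] [ChartedSpace H G] [Group G]

/-- The modular function `λ` of a Lie group, normalized by `μ (A g) = λ g * μ A` for left Haar
measures `μ`, see `measure_image_mul_right`. Mathlib's `modularCharacterFun g` is the scaling
factor of `A ↦ μ (A g⁻¹)`, whence the inverse. -/
def lieModularFunction [FiniteDimensional ℝ E] [LieGroup I ∞ G] (g : G) : ℝ :=
  haveI : IsTopologicalGroup G := topologicalGroup_of_lieGroup I ∞
  haveI : LocallyCompactSpace G := Manifold.locallyCompact_of_finiteDimensional I
  (Measure.modularCharacterFun g⁻¹ : ℝ)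

theorem lieModularFunction_pos [FiniteDimensional ℝ E] [LieGroup I ∞ G] (g : G) :
    0 < lieModularFunction I g := by
  have : IsTopologicalGroup G := topologicalGroup_of_lieGroup I ∞
  have : LocallyCompactSpace G := Manifold.locallyCompact_of_finiteDimensional I
  exact_mod_cast Measure.modularCharacterFun_pos (g⁻¹)

/-- The defining property of the modular function, for every left Haar measure. -/
theorem measure_image_mul_right [FiniteDimensional ℝ E] [SecondCountableTopology G]
    [LieGroup I ∞ G] [MeasurableSpace G] [BorelSpace G] (μ : Measure G) [μ.IsHaarMeasure]
    (g : G) {A : Set G} (hA : MeasurableSet A) :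
    μ ((fun x => x * g) '' A) = ENNReal.ofReal (lieModularFunction I g) * μ A := by
  have : IsTopologicalGroup G := topologicalGroup_of_lieGroup I ∞
  have : LocallyCompactSpace G := Manifold.locallyCompact_of_finiteDimensional I
  have h1 : (fun x => x * g) '' A = (fun x => x * g⁻¹) ⁻¹' A := by
    rw [Set.image_mul_right]
  have h2 := Measure.isMulLeftInvariant_eq_smul (μ.map (· * g⁻¹)) μ
  rw [h1, ← Measure.map_apply (measurable_mul_const g⁻¹) hA, h2,
    ← Measure.modularCharacterFun_eq_haarScalarFactor μ g⁻¹]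
  rw [lieModularFunction, ENNReal.ofReal_coe_nnreal]
  rfl

end Modular

end

/-!
The proof is infinitesimal and needs no density for the Haar measure. Let `μ` be a left Haar
measure, `γ` the one-parameter subgroup generated by `v`, and `λ` the modular function. For a
compactly supported `C¹` function `f`, right translation gives `∫ f (x γ(t)) dμ = λ(γ(t))⁻¹ ∫ f dμ`,
and differentiating under the integral sign at `t = 0`
(`IsMIntegralCurve.hasDerivAt_integral_mul`) expresses the derivative of `λ(γ(t))⁻¹` through
the integral of the derivative of `f` along the left-invariant field of `v`.

At a point `x` that left-invariant field is the right-invariant field generated by `Ad x v`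
(`leftInvariantDeriv_eq_rightInvariantDeriv_lieAd`), i.e. a combination `∑ aₖ(x) eₖ` of the
right-invariant fields of a basis, with `aₖ` the coordinates of `Ad x v`. Right-invariant fields
generate left translations, so derivatives along them integrate to zero against `μ`
(`integral_rightInvariantDeriv_eq_zero`), and an integration by parts moves them from `f` to the
coefficients: the integral equals `-∫ f h dμ` with `h` the sum of the derivatives of the `aₖ` along
the `eₖ`. The function `h` is continuous, and `h 1 = -tr (ad v)` because the derivative of `Ad` at
the identity is the Lie bracket (`HasMFDerivAt.lieAd_one_apply`). Letting the support of `f` shrink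
to the identity gives the derivative `tr (ad v)` of `λ(γ(t))⁻¹` at `0`
(`IsMIntegralCurve.hasDerivAt_lieModularFunction_inv`). As `λ ∘ γ` is a homomorphism, it follows
that `λ(exp v) = exp (-tr (ad v))` (`lieModularFunction_lieExp`), and the theorem is obtained by
multiplicativity of `λ` and by writing the trace with structure constants.
-/

noncomputable section

open Set Filter VectorField
open scoped Topology Pointwise

/-! ### The adjoint action and its derivative -/

section Adjoint

variable {E : Type*} [NormedAddCommGroup E] [NormedSpace ℝ E] {H : Type*} [TopologicalSpace H]
  {I : ModelWithCorners ℝ E H} {G : Type*} [TopologicalSpace G] [ChartedSpace H G] [Group G]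

variable (I) in
/-- The adjoint action of `x : G` on the Lie algebra, i.e. the derivative at `1` of `y ↦ x y x⁻¹`.
It is regarded as an endomorphism of the model space `E`, which is the tangent space at every
point by definition, so that its dependence on `x` can be differentiated. -/
def lieAd (x : G) : E →L[ℝ] E :=
  (mfderiv I I (fun y : G => x * y * x⁻¹) 1 :
    TangentSpace I (1 : G) →L[ℝ] TangentSpace I (x * 1 * x⁻¹))

variable (I G) in
/-- The multiplication of a Lie group in the preferred chart at the identity. It is meaningful only
for pairs close to the image of `(1, 1)`. -/
def chartMul (z : E × E) : E :=
  extChartAt I (1 : G) ((extChartAt I (1 : G)).symm z.1 * (extChartAt I (1 : G)).symm z.2)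

omit [Group G] in
theorem HasMFDerivAt.hasFDerivAt_comp_extChartAt_symm [I.Boundaryless]
    {F : Type*} [NormedAddCommGroup F] [NormedSpace ℝ F] {f : G → F} {x : G} {L : E →L[ℝ] F}
    (h : HasMFDerivAt I 𝓘(ℝ, F) f x L) :
    HasFDerivAt (fun y => f ((extChartAt I x).symm y)) L (extChartAt I x x) := by
  have h2 : HasFDerivWithinAt (fun y => f ((extChartAt I x).symm y)) L (range I)
    (extChartAt I x x) := h.2
  rwa [I.range_eq_univ, hasFDerivWithinAt_univ] at h2

theorem hasMFDerivAt_conj [LieGroup I ∞ G] (x : G) :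
    HasMFDerivAt I I (fun y : G => x * y * x⁻¹) 1 (lieAd (E := E) I x) := by
  have h : ContMDiff I I ∞ (fun y : G => x * y * x⁻¹) :=
    (contMDiff_const.mul contMDiff_id).mul contMDiff_const
  exact (h.contMDiffAt.mdifferentiableAt (by simp)).hasMFDerivAt

theorem hasFDerivAt_chart_conj [I.Boundaryless] [LieGroup I ∞ G] (x : G) :
    HasFDerivAt (fun y : E => extChartAt I (1 : G) (x * (extChartAt I (1 : G)).symm y * x⁻¹))
      (lieAd I x) (extChartAt I (1 : G) 1) := by
  have h : HasFDerivWithinAt (fun y : E => extChartAt I (x * 1 * x⁻¹)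
      (x * (extChartAt I (1 : G)).symm y * x⁻¹)) (lieAd I x) (range I) (extChartAt I (1 : G) 1) :=
    (hasMFDerivAt_conj (I := I) x).2
  have hx : x * 1 * x⁻¹ = 1 := by simp
  rwa [I.range_eq_univ, hasFDerivWithinAt_univ, hx] at h

/-- The conjugations fix `1`, so that the tangent coordinates in which parametrized derivatives are
known to be smooth are trivial here, and the adjoint action is smooth as a map to `E →L[ℝ] E`. -/
theorem contMDiff_lieAd [LieGroup I ∞ G] :
    ContMDiff I 𝓘(ℝ, E →L[ℝ] E) 1 (lieAd I : G → E →L[ℝ] E) := by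
  have : IsManifold I 1 G := IsManifold.of_le (n := ∞) (by simp)
  intro x₀
  have hf : ContMDiffAt (I.prod I) I ∞
      (Function.uncurry fun x y : G => x * y * x⁻¹) (x₀, (1 : G)) := by
    have : ContMDiff (I.prod I) I ∞ (fun z : G × G => z.1 * z.2 * z.1⁻¹) :=
      (contMDiff_fst.mul contMDiff_snd).mul contMDiff_fst.inv
    exact this.contMDiffAt
  have h := ContMDiffAt.mfderiv (m := 1) (fun x y : G => x * y * x⁻¹) (fun _ => (1 : G)) hf
    contMDiffAt_const (by rw [one_add_one_eq_two]; exact ENat.LEInfty.out)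
  refine h.congr_of_eventuallyEq (Eventually.of_forall fun x => ?_)
  have hc : ∀ x : G, x * 1 * x⁻¹ = 1 := fun x => by simp
  have h1 : ∀ y z : G, y = 1 → z = 1 →
      (mfderiv I 𝓘(ℝ, E) (extChartAt I y) z : E →L[ℝ] E) = ContinuousLinearMap.id ℝ E := by
    rintro _ _ rfl rfl; exact mfderiv_extChartAt_self
  have h2 : (mfderivWithin 𝓘(ℝ, E) I (extChartAt I (1 : G)).symm (range I) (extChartAt I (1 : G) 1)
      : E →L[ℝ] E) = ContinuousLinearMap.id ℝ E := mfderivWithin_range_extChartAt_symm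
  have h3 := inTangentCoordinates_eq_mfderiv_comp (I := I) (I' := I) (f := fun _ : G => (1 : G))
    (g := fun x : G => x * 1 * x⁻¹) (ϕ := fun x => mfderiv I I (fun y : G => x * y * x⁻¹) 1)
    (x₀ := x₀) (x := x) (mem_chart_source H (1 : G))
    (by rw [hc, hc]; exact mem_chart_source H (1 : G))
  refine Eq.trans ?_ h3.symm
  exact (congrArg₂ (fun A B : E →L[ℝ] E => A ∘L (lieAd I x) ∘L B)
    (h1 _ _ (hc x₀) (hc x)) h2).symm

variable [I.Boundaryless] [LieGroup I ∞ G]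

omit [LieGroup I ∞ G] in
theorem eventually_mem_extChartAt_one_target :
    ∀ᶠ y in 𝓝 (extChartAt I (1 : G) 1), y ∈ (extChartAt I (1 : G)).target :=
  extChartAt_target_mem_nhds (I := I) (1 : G)

theorem contDiffAt_chartMul :
    ContDiffAt ℝ ∞ (chartMul I G) (extChartAt I (1 : G) 1, extChartAt I (1 : G) 1) := by
  rw [← contMDiffAt_iff_contDiffAt]
  set p := extChartAt I (1 : G) 1
  have hs : ContMDiffAt 𝓘(ℝ, E) I ∞ (extChartAt I (1 : G)).symm p := by
    have := contMDiffOn_extChartAt_symm (I := I) (n := ∞) (1 : G)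
    exact this.contMDiffAt (extChartAt_target_mem_nhds (I := I) (1 : G))
  have hp : (extChartAt I (1 : G)).symm p = 1 := extChartAt_to_inv (I := I) (1 : G)
  have h1 : ContMDiffAt 𝓘(ℝ, E × E) I ∞
      (fun z : E × E => (extChartAt I (1 : G)).symm z.1) (p, p) :=
    ContMDiffAt.comp (p, p) hs contDiffAt_fst.contMDiffAt
  have h2 : ContMDiffAt 𝓘(ℝ, E × E) I ∞
      (fun z : E × E => (extChartAt I (1 : G)).symm z.2) (p, p) :=
    ContMDiffAt.comp (p, p) hs contDiffAt_snd.contMDiffAt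
  refine ContMDiffAt.comp (p, p) ?_ (h1.mul h2)
  have : (extChartAt I (1 : G)).symm p * (extChartAt I (1 : G)).symm p = 1 := by rw [hp, mul_one]
  simp only [this]
  exact contMDiffAt_extChartAt

/-- In the chart at the identity, the left-invariant vector field of `v` is the partial derivative
of the multiplication in its second argument at the identity, applied to `v`. -/
theorem mpullbackWithin_mulInvariantVectorField_eventuallyEq (v : GroupLieAlgebra I G) :
    mpullbackWithin 𝓘(ℝ, E) I (extChartAt I (1 : G)).symm (mulInvariantVectorField v) (range I)
      =ᶠ[𝓝 (extChartAt I (1 : G) 1)]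
    fun y => (fderiv ℝ (chartMul I G) (y, extChartAt I (1 : G) 1) ((0 : E), (v : E)) : E) := by
  have : IsManifold I 1 G := IsManifold.of_le (n := ∞) (by simp)
  set p := extChartAt I (1 : G) 1 with hp
  have hd : ∀ᶠ y in 𝓝 p, DifferentiableAt ℝ (chartMul I G) (y, p) := by
    have h := ((contDiffAt_chartMul (I := I) (G := G)).of_le (m := 1)
      (by exact_mod_cast le_top)).eventually (by simp)
    have hc : Tendsto (fun y : E => (y, p)) (𝓝 p) (𝓝 (p, p)) :=
      (continuous_id.prodMk continuous_const).continuousAt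
    filter_upwards [hc.eventually h] with y hy using hy.differentiableAt (by simp)
  filter_upwards [hd, eventually_mem_extChartAt_one_target (I := I) (G := G)] with y hy hyt
  set g := (extChartAt I (1 : G)).symm y with hg
  have hgs : g ∈ (extChartAt I (1 : G)).source := (extChartAt I (1 : G)).map_target hyt
  have hinv : (mfderivWithin 𝓘(ℝ, E) I (extChartAt I (1 : G)).symm (range I) y).inverse =
      mfderiv I 𝓘(ℝ, E) (extChartAt I (1 : G)) g :=
    ContinuousLinearMap.inverse_eq (mfderivWithin_extChartAt_symm_comp_mfderiv_extChartAt hyt)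
      (mfderiv_extChartAt_comp_mfderivWithin_extChartAt_symm hyt)
  rw [mpullbackWithin_apply, hinv]
  let A : E →L[ℝ] E := (mfderiv I 𝓘(ℝ, E) (extChartAt I (1 : G)) g :
    TangentSpace I g →L[ℝ] TangentSpace 𝓘(ℝ, E) (extChartAt I (1 : G) g))
  let B : E →L[ℝ] E := (mfderiv I I (fun z : G => g * z) 1 :
    TangentSpace I (1 : G) →L[ℝ] TangentSpace I (g * 1))
  have hA : ∀ z, z = g → HasMFDerivAt I 𝓘(ℝ, E) (extChartAt I (1 : G)) z A := by
    rintro _ rfl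
    exact (mdifferentiableAt_extChartAt (by rwa [extChartAt_source] at hgs)).hasMFDerivAt
  have hB : HasMFDerivAt I I (fun z : G => g * z) 1 B :=
    ((contMDiff_mul_left (I := I) (n := ∞) (a := g)).contMDiffAt.mdifferentiableAt
      (by simp)).hasMFDerivAt
  have h1 : HasMFDerivAt I 𝓘(ℝ, E) (fun z : G => extChartAt I (1 : G) (g * z)) 1 (A ∘L B) :=
    (hA (g * 1) (mul_one g)).comp 1 hB
  have h2 : HasFDerivAt (fun z : E => chartMul I G (y, z)) (A ∘L B) p :=
    h1.hasFDerivAt_comp_extChartAt_symm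
  have h3 : HasFDerivAt (fun z : E => chartMul I G (y, z))
      (fderiv ℝ (chartMul I G) (y, p) ∘L ContinuousLinearMap.inr ℝ E E) p :=
    hy.hasFDerivAt.comp p (hasFDerivAt_prodMk_right y p)
  exact DFunLike.congr_fun (h2.unique h3) (v : E)

/-- The derivative of the adjoint action at the identity is the Lie bracket. If `B` is the mixed
second derivative at `(1, 1)` of the multiplication in a chart, both sides at `w`, `v` are equal to
`B w v - B v w`. -/
theorem HasMFDerivAt.lieAd_one_apply {A : E →L[ℝ] E →L[ℝ] E}
    (hA : HasMFDerivAt I 𝓘(ℝ, E →L[ℝ] E) (lieAd I : G → E →L[ℝ] E) 1 A)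
    (w v : E) :
    A w v = Bracket.bracket (L := GroupLieAlgebra I G) (M := GroupLieAlgebra I G) w v := by
  have : IsManifold I 1 G := IsManifold.of_le (n := ∞) (by simp)
  set p := extChartAt I (1 : G) 1 with hp
  set M := chartMul I G with hM
  have hs1 : (extChartAt I (1 : G)).symm p = 1 := extChartAt_to_inv (I := I) (1 : G)
  have hMc : ContDiffAt ℝ ∞ M (p, p) := contDiffAt_chartMul
  have hM2 : DifferentiableAt ℝ (fderiv ℝ M) (p, p) :=
    (hMc.fderiv_right (m := 1)
      (by rw [one_add_one_eq_two]; exact ENat.LEInfty.out)).differentiableAt (by simp)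
  have hsymm : IsSymmSndFDerivAt ℝ M (p, p) :=
    hMc.isSymmSndFDerivAt
      (by simp only [minSmoothness_of_isRCLikeNormedField]; exact ENat.LEInfty.out)
  set D := fderiv ℝ (fderiv ℝ M) (p, p) with hD
  have hl : HasFDerivAt (fun y : E => fderiv ℝ M (y, p)) (D ∘L ContinuousLinearMap.inl ℝ E E) p :=
    HasFDerivAt.comp p (f := fun y : E => (y, p)) hM2.hasFDerivAt (hasFDerivAt_prodMk_left p p)
  have hr : HasFDerivAt (fun y : E => fderiv ℝ M (p, y)) (D ∘L ContinuousLinearMap.inr ℝ E E) p :=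
    HasFDerivAt.comp p (f := fun y : E => (p, y)) hM2.hasFDerivAt (hasFDerivAt_prodMk_right p p)
  have hV : ∀ u : E, HasFDerivAt (fun y : E => fderiv ℝ M (y, p) ((0 : E), u))
      (((D ∘L ContinuousLinearMap.inl ℝ E E).flip) ((0 : E), u)) p := by
    intro u
    have h2 := hl.clm_apply (hasFDerivAt_const ((0 : E), u) p)
    convert h2 using 1
    simp
  have hd : HasFDerivAt M (fderiv ℝ M (p, p)) (p, p) :=
    (hMc.differentiableAt (by simp)).hasFDerivAt
  have ht := eventually_mem_extChartAt_one_target (I := I) (G := G)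
  -- the identity is neutral, so both partial derivatives of `M` at `(p, p)` are trivial
  have hval : ∀ u : E, fderiv ℝ M (p, p) ((0 : E), u) = u := by
    intro u
    have h1 := HasFDerivAt.comp p (f := fun y : E => (p, y)) hd (hasFDerivAt_prodMk_right p p)
    have h2 : HasFDerivAt (M ∘ fun y : E => (p, y)) (ContinuousLinearMap.id ℝ E) p := by
      refine (hasFDerivAt_id p).congr_of_eventuallyEq ?_
      filter_upwards [ht] with y hy
      simp only [Function.comp_apply, hM, chartMul, hs1, one_mul, id]
      exact (extChartAt I (1 : G)).right_inv hy
    simpa using DFunLike.congr_fun (h1.unique h2) u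
  have hval' : ∀ u : E, fderiv ℝ M (p, p) (u, (0 : E)) = u := by
    intro u
    have h1 := HasFDerivAt.comp p (f := fun y : E => (y, p)) hd (hasFDerivAt_prodMk_left p p)
    have h2 : HasFDerivAt (M ∘ fun y : E => (y, p)) (ContinuousLinearMap.id ℝ E) p := by
      refine (hasFDerivAt_id p).congr_of_eventuallyEq ?_
      filter_upwards [ht] with y hy
      simp only [Function.comp_apply, hM, chartMul, hs1, mul_one, id]
      exact (extChartAt I (1 : G)).right_inv hy
    simpa using DFunLike.congr_fun (h1.unique h2) u
  -- the bracket in terms of the second derivative of the multiplication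
  have hbr : (Bracket.bracket (L := GroupLieAlgebra I G) (M := GroupLieAlgebra I G) w v : E) =
      D (w, 0) (0, v) - D (v, 0) (0, w) := by
    have key : ∀ (V W : E → E) (a b : E) (L L' : E →L[ℝ] E), V p = a → W p = b →
        HasFDerivAt V L p → HasFDerivAt W L' p → lieBracketWithin ℝ V W univ p = L' a - L b := by
      intro V W a b L L' hVp hWp hVd hWd
      rw [lieBracketWithin_univ, lieBracket, hVp, hWp, hVd.fderiv, hWd.fderiv]
    have hφ : (mfderiv I 𝓘(ℝ, E) (extChartAt I (1 : G)) 1).inverse =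
        ContinuousLinearMap.id ℝ E := by
      rw [mfderiv_extChartAt_self]; exact ContinuousLinearMap.inverse_id
    have h0 : ∀ u : GroupLieAlgebra I G, (mpullbackWithin 𝓘(ℝ, E) I (extChartAt I (1 : G)).symm
        (mulInvariantVectorField u) (range I) p : E) = u ∧
        HasFDerivAt (mpullbackWithin 𝓘(ℝ, E) I (extChartAt I (1 : G)).symm
          (mulInvariantVectorField u) (range I) : E → E)
          (((D ∘L ContinuousLinearMap.inl ℝ E E).flip) ((0 : E), (u : E))) p := fun u => by
      have he := mpullbackWithin_mulInvariantVectorField_eventuallyEq (I := I) (G := G) u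
      exact ⟨he.eq_of_nhds.trans (hval u), (hV u).congr_of_eventuallyEq he⟩
    have hs : (extChartAt I (1 : G)).symm ⁻¹' univ ∩ range I = univ := by simp [I.range_eq_univ]
    have hb : ∀ w v : GroupLieAlgebra I G, ⁅w, v⁆ = ContinuousLinearMap.id ℝ E (lieBracketWithin ℝ
        (mpullbackWithin 𝓘(ℝ, E) I (extChartAt I (1 : G)).symm
          (mulInvariantVectorField w) (range I) : E → E)
        (mpullbackWithin 𝓘(ℝ, E) I (extChartAt I (1 : G)).symm
          (mulInvariantVectorField v) (range I) : E → E) univ p) := fun w v => by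
      rw [GroupLieAlgebra.bracket_def, ← mlieBracketWithin_univ, mlieBracketWithin_apply, hs, hφ]
      rfl
    refine (hb w v).trans ((key _ _ w v _ _ (h0 w).1 (h0 v).1 (h0 w).2 (h0 v).2).trans ?_)
    simp
  have hAd : HasFDerivAt (fun y : E => lieAd I ((extChartAt I (1 : G)).symm y)) A p :=
    hA.hasFDerivAt_comp_extChartAt_symm
  -- `x y = (x y x⁻¹) x`, differentiated in `y` at the identity
  have hrel : (fun x : E => fderiv ℝ M (p, x) (lieAd I ((extChartAt I (1 : G)).symm x) v, (0 : E)))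
      =ᶠ[𝓝 p] fun x : E => fderiv ℝ M (x, p) ((0 : E), (v : E)) := by
    have hev : ∀ᶠ z in 𝓝 (p, p), DifferentiableAt ℝ M z := by
      have h := (hMc.of_le (m := 1) (by exact_mod_cast le_top)).eventually (by simp)
      filter_upwards [h] with z hz using hz.differentiableAt (by simp)
    have hc1 : Tendsto (fun y : E => (y, p)) (𝓝 p) (𝓝 (p, p)) :=
      (continuous_id.prodMk continuous_const).continuousAt
    have hc2 : Tendsto (fun y : E => (p, y)) (𝓝 p) (𝓝 (p, p)) :=
      (continuous_const.prodMk continuous_id).continuousAt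
    filter_upwards [hc1.eventually hev, hc2.eventually hev] with x hx1 hx2
    set X := (extChartAt I (1 : G)).symm x with hX
    have hC := hasFDerivAt_chart_conj (I := I) X
    have hCp : extChartAt I (1 : G) (X * (extChartAt I (1 : G)).symm p * X⁻¹) = p := by
      rw [hs1, mul_one, mul_inv_cancel]
    have h1 : HasFDerivAt (M ∘ fun y : E =>
        (extChartAt I (1 : G) (X * (extChartAt I (1 : G)).symm y * X⁻¹), x))
        (fderiv ℝ M (p, x) ∘L (lieAd I X).prod 0) p :=
      HasFDerivAt.comp p (by rw [hCp]; exact hx2.hasFDerivAt) (hC.prodMk (hasFDerivAt_const x p))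
    have h2 : HasFDerivAt (M ∘ fun y : E => (x, y))
        (fderiv ℝ M (x, p) ∘L ContinuousLinearMap.inr ℝ E E) p :=
      HasFDerivAt.comp p (f := fun y : E => (x, y)) hx1.hasFDerivAt (hasFDerivAt_prodMk_right x p)
    have hTG : IsTopologicalGroup G := topologicalGroup_of_lieGroup I ∞
    have hsrc : ∀ᶠ y in 𝓝 p,
        X * (extChartAt I (1 : G)).symm y * X⁻¹ ∈ (extChartAt I (1 : G)).source := by
      have hcont : ContinuousAt (fun y => X * (extChartAt I (1 : G)).symm y * X⁻¹) p :=
        (continuousAt_const.mul (continuousAt_extChartAt_symm (I := I) (1 : G))).mul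
          continuousAt_const
      refine hcont.eventually ?_
      simp only [hs1, mul_one, mul_inv_cancel]
      exact extChartAt_source_mem_nhds (I := I) (1 : G)
    have heq : (M ∘ fun y : E => (x, y)) =ᶠ[𝓝 p] (M ∘ fun y : E =>
        (extChartAt I (1 : G) (X * (extChartAt I (1 : G)).symm y * X⁻¹), x)) := by
      filter_upwards [hsrc] with y hy
      simp only [Function.comp_apply, hM, chartMul]
      rw [(extChartAt I (1 : G)).left_inv hy, ← hX, inv_mul_cancel_right]
    have h3 := DFunLike.congr_fun ((h1.congr_of_eventuallyEq heq).unique h2) (v : E)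
    simpa using h3
  have hA1 : lieAd I (1 : G) = ContinuousLinearMap.id ℝ E := by
    have h := hasFDerivAt_chart_conj (I := I) (1 : G)
    refine h.unique ((hasFDerivAt_id p).congr_of_eventuallyEq ?_)
    filter_upwards [ht] with y hy
    rw [one_mul, inv_one, mul_one]
    exact (extChartAt I (1 : G)).right_inv hy
  -- differentiate `hrel` at `p` in direction `w`; the symmetry of `D` then identifies the result
  -- with the bracket
  have h1 := (hr.clm_apply (((hAd.clm_apply (hasFDerivAt_const (v : E) p)).prodMk
    (hasFDerivAt_const (0 : E) p)))).unique ((hV v).congr_of_eventuallyEq hrel)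
  have h2 : (D (0, w) (v, 0) + A w v : E) = D (w, 0) (0, v) := by
    have h3 := DFunLike.congr_fun h1 (w : E)
    rw [hs1, hA1] at h3
    simpa [hval', add_comm] using h3
  rw [hbr, hsymm.eq (v, 0) (0, w), ← h2, add_sub_cancel_left]

end Adjoint

/-! ### Derivatives along invariant vector fields -/

section InvariantDerivatives

variable {E : Type*} [NormedAddCommGroup E] [NormedSpace ℝ E] {H : Type*} [TopologicalSpace H]
  {I : ModelWithCorners ℝ E H} {G : Type*} [TopologicalSpace G] [ChartedSpace H G] [Group G]

variable (I) in
/-- The derivatives of a function `f` at `x` along the left-invariant vector fields, as a linear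
form in the vector of the Lie algebra that generates the field. -/
def leftInvariantDeriv (f : G → ℝ) (x : G) : E →L[ℝ] ℝ :=
  (mfderiv I 𝓘(ℝ, ℝ) (fun y : G => f (x * y)) 1 :
    TangentSpace I (1 : G) →L[ℝ] TangentSpace 𝓘(ℝ, ℝ) (f (x * 1)))

variable (I) in
/-- The derivatives of a function `f` at `x` along the right-invariant vector fields, as a linear
form in the vector of the Lie algebra that generates the field. -/
def rightInvariantDeriv (f : G → ℝ) (x : G) : E →L[ℝ] ℝ :=
  (mfderiv I 𝓘(ℝ, ℝ) (fun y : G => f (y * x)) 1 :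
    TangentSpace I (1 : G) →L[ℝ] TangentSpace 𝓘(ℝ, ℝ) (f (1 * x)))

variable [LieGroup I ∞ G]

theorem hasMFDerivAt_leftInvariantDeriv {f : G → ℝ} (hf : ContMDiff I 𝓘(ℝ, ℝ) 1 f) (x : G) :
    HasMFDerivAt I 𝓘(ℝ, ℝ) (fun y : G => f (x * y)) 1 (leftInvariantDeriv (E := E) I f x) :=
  have : ContMDiff I 𝓘(ℝ, ℝ) 1 (fun y : G => f (x * y)) :=
    hf.comp ((contMDiff_mul_left (I := I) (n := ∞) (a := x)).of_le (by simp))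
  (this.contMDiffAt.mdifferentiableAt (by simp)).hasMFDerivAt

theorem hasMFDerivAt_rightInvariantDeriv {f : G → ℝ} (hf : ContMDiff I 𝓘(ℝ, ℝ) 1 f) (x : G) :
    HasMFDerivAt I 𝓘(ℝ, ℝ) (fun y : G => f (y * x)) 1 (rightInvariantDeriv (E := E) I f x) :=
  have : ContMDiff I 𝓘(ℝ, ℝ) 1 (fun y : G => f (y * x)) :=
    hf.comp ((contMDiff_mul_right (I := I) (n := ∞) (a := x)).of_le (by simp))
  (this.contMDiffAt.mdifferentiableAt (by simp)).hasMFDerivAt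

/-- A `C¹` function of two variables has a continuous partial derivative at a fixed point of the
second variable. -/
theorem continuous_mfderiv_one {F : G → G → ℝ}
    (hF : ContMDiff (I.prod I) 𝓘(ℝ, ℝ) 1 (Function.uncurry F)) {L : G → E →L[ℝ] ℝ}
    (hL : ∀ x, HasMFDerivAt I 𝓘(ℝ, ℝ) (F x) 1 (L x)) : Continuous L := by
  have : IsManifold I 1 G := IsManifold.of_le (n := ∞) (by simp)
  rw [continuous_iff_continuousAt]
  intro x₀
  have h := ContMDiffAt.mfderiv (m := 0) F (fun _ => (1 : G)) (x₀ := x₀) hF.contMDiffAt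
    contMDiffAt_const (by simp)
  refine h.continuousAt.congr (Eventually.of_forall fun x => ?_)
  have h1 : ∀ y z : ℝ, (mfderiv 𝓘(ℝ, ℝ) 𝓘(ℝ, ℝ) (extChartAt 𝓘(ℝ, ℝ) y) z : ℝ →L[ℝ] ℝ) =
      ContinuousLinearMap.id ℝ ℝ := fun y z =>
    ((hasMFDerivAt_id z).congr_of_eventuallyEq (Eventually.of_forall fun _ => by
      rw [extChartAt_model_space_eq_id]; rfl)).mfderiv
  have h2 : (mfderivWithin 𝓘(ℝ, E) I (extChartAt I (1 : G)).symm (range I) (extChartAt I (1 : G) 1)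
      : E →L[ℝ] E) = ContinuousLinearMap.id ℝ E := mfderivWithin_range_extChartAt_symm
  have h3 := inTangentCoordinates_eq_mfderiv_comp (I := I) (I' := 𝓘(ℝ, ℝ))
    (f := fun _ : G => (1 : G))
    (g := fun x : G => F x 1) (ϕ := fun x => mfderiv I 𝓘(ℝ, ℝ) (F x) 1)
    (x₀ := x₀) (x := x) (mem_chart_source H (1 : G))
    (by rw [chartAt_self_eq]; exact mem_univ _)
  refine Eq.trans h3 ?_
  rw [(hL x).mfderiv]
  exact congrArg₂ (fun (A : ℝ →L[ℝ] ℝ) (B : E →L[ℝ] E) => A ∘L L x ∘L B) (h1 _ _) h2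

theorem continuous_leftInvariantDeriv {f : G → ℝ} (hf : ContMDiff I 𝓘(ℝ, ℝ) 1 f) :
    Continuous (leftInvariantDeriv I f : G → E →L[ℝ] ℝ) :=
  continuous_mfderiv_one (F := fun x y => f (x * y))
    (hf.comp ((contMDiff_mul I ∞).of_le (by simp))) (hasMFDerivAt_leftInvariantDeriv hf)

theorem continuous_rightInvariantDeriv {f : G → ℝ} (hf : ContMDiff I 𝓘(ℝ, ℝ) 1 f) :
    Continuous (rightInvariantDeriv I f : G → E →L[ℝ] ℝ) :=
  continuous_mfderiv_one (F := fun x y => f (y * x))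
    (hf.comp (((contMDiff_mul I ∞).of_le (by simp)).comp (contMDiff_snd.prodMk contMDiff_fst)))
    (hasMFDerivAt_rightInvariantDeriv hf)

theorem leftInvariantDeriv_eq_zero_of_notMem_tsupport {f : G → ℝ} {x : G} (hx : x ∉ tsupport f) :
    leftInvariantDeriv (E := E) I f x = 0 := by
  have : IsTopologicalGroup G := topologicalGroup_of_lieGroup I ∞
  have h : (fun y : G => f (x * y)) =ᶠ[𝓝 1] fun _ => 0 := by
    have hc : Tendsto (fun y : G => x * y) (𝓝 1) (𝓝 x) := by
      simpa using (continuous_const_mul x).tendsto (1 : G)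
    exact hc.eventually (notMem_tsupport_iff_eventuallyEq.1 hx)
  have h2 : HasMFDerivAt I 𝓘(ℝ, ℝ) (fun y : G => f (x * y)) 1 (0 : E →L[ℝ] ℝ) :=
    (hasMFDerivAt_const (0 : ℝ) (1 : G)).congr_of_eventuallyEq h
  exact h2.mfderiv

theorem rightInvariantDeriv_eq_zero_of_notMem_tsupport {f : G → ℝ} {x : G} (hx : x ∉ tsupport f) :
    rightInvariantDeriv (E := E) I f x = 0 := by
  have : IsTopologicalGroup G := topologicalGroup_of_lieGroup I ∞
  have h : (fun y : G => f (y * x)) =ᶠ[𝓝 1] fun _ => 0 := by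
    have hc : Tendsto (fun y : G => y * x) (𝓝 1) (𝓝 x) := by
      simpa using (continuous_mul_const x).tendsto (1 : G)
    exact hc.eventually (notMem_tsupport_iff_eventuallyEq.1 hx)
  have h2 : HasMFDerivAt I 𝓘(ℝ, ℝ) (fun y : G => f (y * x)) 1 (0 : E →L[ℝ] ℝ) :=
    (hasMFDerivAt_const (0 : ℝ) (1 : G)).congr_of_eventuallyEq h
  exact h2.mfderiv

/-- The left-invariant field of `v` is at `x` the right-invariant field of `lieAd I x v`, because
`x y = (x y x⁻¹) x`. -/
theorem leftInvariantDeriv_eq_rightInvariantDeriv_lieAd {f : G → ℝ}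
    (hf : ContMDiff I 𝓘(ℝ, ℝ) 1 f) (x : G) (v : E) :
    leftInvariantDeriv I f x v = rightInvariantDeriv I f x (lieAd I x v) := by
  have h1 : ∀ y : G, y = 1 → HasMFDerivAt I 𝓘(ℝ, ℝ) (fun y : G => f (y * x)) y
      (rightInvariantDeriv (E := E) I f x) := by
    rintro _ rfl; exact hasMFDerivAt_rightInvariantDeriv hf x
  have h2 := (h1 (x * 1 * x⁻¹) (by simp)).comp 1 (hasMFDerivAt_conj (I := I) x)
  have h3 : HasMFDerivAt I 𝓘(ℝ, ℝ) (fun y : G => f (x * y)) 1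
      (rightInvariantDeriv (E := E) I f x ∘L lieAd (E := E) I x) :=
    h2.congr_of_eventuallyEq (Eventually.of_forall fun y => by simp)
  exact DFunLike.congr_fun (F := E →L[ℝ] ℝ)
    (hasMFDerivAt_unique (hasMFDerivAt_leftInvariantDeriv hf x) h3) v

theorem rightInvariantDeriv_mul {f g : G → ℝ} (hf : ContMDiff I 𝓘(ℝ, ℝ) 1 f)
    (hg : ContMDiff I 𝓘(ℝ, ℝ) 1 g) (x : G) (v : E) :
    rightInvariantDeriv I (fun y => f y * g y) x v =
      f x * rightInvariantDeriv I g x v + g x * rightInvariantDeriv I f x v := by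
  have h := (hasMFDerivAt_rightInvariantDeriv hf x).mul (hasMFDerivAt_rightInvariantDeriv hg x)
  have h2 := DFunLike.congr_fun (F := E →L[ℝ] ℝ)
    (hasMFDerivAt_unique (hasMFDerivAt_rightInvariantDeriv (hf.mul hg) x) h) v
  refine h2.trans ?_
  change f (1 * x) * _ + g (1 * x) * _ = _
  simp only [one_mul]
  rfl

omit [LieGroup I ∞ G] in
theorem mulInvariantVectorField_one (v : GroupLieAlgebra I G) :
    mulInvariantVectorField v (1 : G) = v := by
  have h : HasMFDerivAt I I (fun y : G => 1 * y) 1 (ContinuousLinearMap.id ℝ E) :=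
    (hasMFDerivAt_id 1).congr_of_eventuallyEq (Eventually.of_forall fun y => one_mul y)
  exact DFunLike.congr_fun (F := E →L[ℝ] E) h.mfderiv v

variable {v : GroupLieAlgebra I G} {γ : ℝ → G}

theorem IsMIntegralCurve.const_mul (hγ : IsMIntegralCurve γ (mulInvariantVectorField v)) (x : G) :
    IsMIntegralCurve (fun t => x * γ t) (mulInvariantVectorField v) := by
  intro t
  have h2 : HasMFDerivAt I I (fun z : G => x * z) (γ t) (mfderiv I I (fun z : G => x * z) (γ t)) :=
    ((contMDiff_mul_left (I := I) (n := ∞) (a := x)).contMDiffAt.mdifferentiableAt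
      (by simp)).hasMFDerivAt
  have h3 := h2.comp t (hγ t)
  have h4 : (ContinuousLinearMap.smulRight (1 : ℝ →L[ℝ] ℝ)
      (mulInvariantVectorField (I := I) v (x * γ t)) : ℝ →L[ℝ] E) =
      (mfderiv I I (fun z : G => x * z) (γ t)).comp
        (ContinuousLinearMap.smulRight (1 : ℝ →L[ℝ] ℝ) (mulInvariantVectorField v (γ t))) := by
    rw [← mfderiv_mul_left_mulInvariantVectorField]
    refine ContinuousLinearMap.ext fun r => ?_
    exact (map_smul (mfderiv I I (fun z : G => x * z) (γ t)) r
      (mulInvariantVectorField v (γ t))).symm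
  exact h4 ▸ h3

theorem IsMIntegralCurve.map_add_of_map_zero [CompleteSpace E] [I.Boundaryless] [T2Space G]
    (hγ : IsMIntegralCurve γ (mulInvariantVectorField v)) (h0 : γ 0 = 1) (s t : ℝ) :
    γ (s + t) = γ s * γ t := by
  have : IsManifold I 1 G := IsManifold.of_le (n := ∞) (by simp)
  have h := isMIntegralCurve_Ioo_eq_of_contMDiff_boundaryless (I := I) (t₀ := 0)
    (contMDiff_one_mulInvariantVectorField v) (hγ.comp_add s) (hγ.const_mul (γ s)) (by simp [h0])
  have := congrFun h t
  simpa [add_comm] using this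

omit [LieGroup I ∞ G] in
theorem IsMIntegralCurve.hasDerivAt_comp_zero
    (hγ : IsMIntegralCurve γ (mulInvariantVectorField v)) (h0 : γ 0 = 1) {g : G → ℝ}
    {L : E →L[ℝ] ℝ} (hg : HasMFDerivAt I 𝓘(ℝ, ℝ) g 1 L) :
    HasDerivAt (fun t => g (γ t)) (L v) 0 := by
  have h1 := hγ 0
  rw [← h0] at hg
  have h2 := hg.comp 0 h1
  have h3 : HasFDerivAt (fun t => g (γ t)) (L ∘L ((1 : ℝ →L[ℝ] ℝ).smulRight
    (mulInvariantVectorField (I := I) v (γ 0) : E))) 0 := h2.hasFDerivAt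
  have h4 := h3.hasDerivAt
  have h5 : (mulInvariantVectorField (I := I) v (γ 0) : E) = v := by
    rw [h0]; exact mulInvariantVectorField_one v
  have h6 : ∀ u : E, (L ∘L (1 : ℝ →L[ℝ] ℝ).smulRight u) 1 = L u := fun u => by simp
  exact h4.congr_deriv ((h6 _).trans (congrArg L h5))

theorem IsMIntegralCurve.hasDerivAt_comp_mul [CompleteSpace E] [I.Boundaryless] [T2Space G]
    (hγ : IsMIntegralCurve γ (mulInvariantVectorField v)) (h0 : γ 0 = 1) {f : G → ℝ}
    (hf : ContMDiff I 𝓘(ℝ, ℝ) 1 f) (x : G) (t : ℝ) :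
    HasDerivAt (fun s => f (x * γ s)) (leftInvariantDeriv I f (x * γ t) v) t := by
  have h := hγ.hasDerivAt_comp_zero h0 (hasMFDerivAt_leftInvariantDeriv hf (x * γ t))
  have h2 : HasDerivAt (fun s => s - t) 1 t := (hasDerivAt_id t).sub_const t
  rw [← sub_self t] at h
  have h3 := HasDerivAt.comp t (h₂ := fun s => f (x * γ t * γ s)) (h := fun s => s - t) h h2
  rw [mul_one] at h3
  refine h3.congr_of_eventuallyEq (Eventually.of_forall fun s => ?_)
  simp only [Function.comp_apply]
  rw [mul_assoc, ← hγ.map_add_of_map_zero h0, add_sub_cancel]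

end InvariantDerivatives

/-! ### Integrals of invariant derivatives -/

section Integrals

variable {E : Type*} [NormedAddCommGroup E] [NormedSpace ℝ E] {H : Type*} [TopologicalSpace H]
  {I : ModelWithCorners ℝ E H} {G : Type*} [TopologicalSpace G] [ChartedSpace H G] [Group G]
  [LieGroup I ∞ G]

theorem hasCompactSupport_leftInvariantDeriv {f : G → ℝ} (hfc : HasCompactSupport f) :
    HasCompactSupport (leftInvariantDeriv I f : G → E →L[ℝ] ℝ) :=
  hfc.mono' fun _ hx => by
    by_contra h; exact hx (leftInvariantDeriv_eq_zero_of_notMem_tsupport h)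

theorem hasCompactSupport_rightInvariantDeriv {f : G → ℝ} (hfc : HasCompactSupport f) :
    HasCompactSupport (rightInvariantDeriv I f : G → E →L[ℝ] ℝ) :=
  hfc.mono' fun _ hx => by
    by_contra h; exact hx (rightInvariantDeriv_eq_zero_of_notMem_tsupport h)

variable {v : GroupLieAlgebra I G} {γ : ℝ → G}

/-- Differentiation under the integral sign along right translations by a one-parameter subgroup. -/
theorem IsMIntegralCurve.hasDerivAt_integral_mul [CompleteSpace E] [I.Boundaryless] [T2Space G]
    [MeasurableSpace G] [BorelSpace G] (μ : Measure G) [IsFiniteMeasureOnCompacts μ]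
    (hγ : IsMIntegralCurve γ (mulInvariantVectorField v)) (h0 : γ 0 = 1) {f : G → ℝ}
    (hf : ContMDiff I 𝓘(ℝ, ℝ) 1 f) (hfc : HasCompactSupport f) :
    HasDerivAt (fun t => ∫ x, f (x * γ t) ∂μ) (∫ x, leftInvariantDeriv I f x v ∂μ) 0 := by
  have hTG : IsTopologicalGroup G := topologicalGroup_of_lieGroup I ∞
  have hγc : Continuous γ := hγ.continuous
  have hφ : Continuous fun x : G => leftInvariantDeriv I f x (v : E) :=
    (continuous_leftInvariantDeriv hf).clm_apply continuous_const
  have hφc : HasCompactSupport fun x : G => leftInvariantDeriv I f x (v : E) :=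
    (hasCompactSupport_leftInvariantDeriv hfc).comp_left (g := fun L : E →L[ℝ] ℝ => L (v : E)) rfl
  obtain ⟨C, hC⟩ := hφc.exists_bound_of_continuous hφ
  -- all the derivatives for `|t| ≤ 1` are supported in a common compact set
  set K : Set G := tsupport f * (γ '' Icc (-1) 1)⁻¹ with hK
  have hKc : IsCompact K := hfc.isCompact.mul (isCompact_Icc.image hγc).inv
  have hbound : ∀ x, ∀ t ∈ Icc (-1 : ℝ) 1,
      ‖leftInvariantDeriv I f (x * γ t) (v : E)‖ ≤ K.indicator (fun _ => C) x := by
    intro x t ht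
    by_cases hx : x ∈ K
    · rw [indicator_of_mem hx]; exact hC _
    · rw [indicator_of_notMem hx, leftInvariantDeriv_eq_zero_of_notMem_tsupport]
      · exact (norm_zero (E := ℝ)).le
      · intro h
        exact hx ⟨x * γ t, h, (γ t)⁻¹, by simpa using mem_image_of_mem γ ht, by simp⟩
  have h := hasDerivAt_integral_of_dominated_loc_of_deriv_le (μ := μ) (x₀ := (0 : ℝ))
    (F := fun t x => f (x * γ t)) (F' := fun t x => leftInvariantDeriv I f (x * γ t) (v : E))
    (bound := K.indicator fun _ => C) (s := Icc (-1) 1) (Icc_mem_nhds (by norm_num) (by norm_num))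
    (Eventually.of_forall fun t =>
      (hf.continuous.comp (continuous_mul_const (γ t))).aestronglyMeasurable)
    (by simpa [h0] using hf.continuous.integrable_of_hasCompactSupport hfc)
    (hφ.comp (continuous_mul_const (γ 0))).aestronglyMeasurable
    (ae_of_all _ hbound)
    ((integrable_indicator_iff hKc.measurableSet).2
      (integrableOn_const hKc.measure_lt_top.ne))
    (ae_of_all _ fun x t _ => hγ.hasDerivAt_comp_mul h0 hf x t)
  simpa [h0] using h.2

/-- Derivatives along right-invariant fields have integral zero for a left-invariant measure.
Inversion turns this into differentiation of a constant integral of right translates, for the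
right-invariant measure `μ.inv`. -/
theorem integral_rightInvariantDeriv_eq_zero [FiniteDimensional ℝ E] [I.Boundaryless] [T2Space G]
    [MeasurableSpace G] [BorelSpace G] (μ : Measure G) [IsFiniteMeasureOnCompacts μ]
    [μ.IsMulLeftInvariant] {f : G → ℝ}
    (hf : ContMDiff I 𝓘(ℝ, ℝ) 1 f) (hfc : HasCompactSupport f) (v : E) :
    ∫ x, rightInvariantDeriv I f x v ∂μ = 0 := by
  have hTG : IsTopologicalGroup G := topologicalGroup_of_lieGroup I ∞
  have hc : CompleteSpace E := FiniteDimensional.complete ℝ E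
  obtain ⟨γ, h0, hγ⟩ := exists_integralCurve_mulInvariantVectorField (I := I) (G := G) v
  have hinv : ContMDiff I 𝓘(ℝ, ℝ) 1 (fun x : G => f x⁻¹) :=
    hf.comp ((contMDiff_inv I ∞).of_le (by simp))
  have hinvc : HasCompactSupport (fun x : G => f x⁻¹) :=
    hfc.comp_homeomorph (Homeomorph.inv G)
  have hγneg : ∀ t, (γ t)⁻¹ = γ (-t) := fun t => by
    rw [inv_eq_iff_mul_eq_one, ← hγ.map_add_of_map_zero h0]; simp [h0]
  -- the inverse of `x γ(t)` is `γ(-t) x⁻¹`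
  have hderiv : ∀ x : G, leftInvariantDeriv I (fun x : G => f x⁻¹) x v =
      -rightInvariantDeriv I f x⁻¹ v := by
    intro x
    have h1 := hγ.hasDerivAt_comp_mul h0 hinv x 0
    rw [h0, mul_one] at h1
    have h2 := hγ.hasDerivAt_comp_zero h0 (hasMFDerivAt_rightInvariantDeriv hf x⁻¹)
    rw [← neg_zero] at h2
    have h3 := HasDerivAt.comp (0 : ℝ) (h₂ := fun t => f (γ t * x⁻¹)) (h := fun t : ℝ => -t) h2
      (hasDerivAt_neg 0)
    rw [mul_neg_one] at h3
    refine h1.unique (h3.congr_of_eventuallyEq (Eventually.of_forall fun t => ?_))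
    simp [hγneg]
  have h := hγ.hasDerivAt_integral_mul μ.inv h0 hinv hinvc
  have hconst : (fun t => ∫ x, f (x * γ t)⁻¹ ∂μ.inv) = fun _ => ∫ x, f x⁻¹ ∂μ.inv := by
    ext t
    exact integral_mul_right_eq_self (fun x => f x⁻¹) (γ t)
  rw [hconst] at h
  have h1 := h.unique (hasDerivAt_const (0 : ℝ) _)
  simp_rw [hderiv] at h1
  have hcont : Continuous fun x : G => rightInvariantDeriv I f x⁻¹ v :=
    ((continuous_rightInvariantDeriv hf).clm_apply continuous_const).comp continuous_inv
  rw [integral_neg, neg_eq_zero, Measure.inv, integral_map measurable_inv.aemeasurable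
    hcont.aestronglyMeasurable] at h1
  simpa using h1

/-- Integration by parts for derivatives along right-invariant fields. -/
theorem integral_mul_rightInvariantDeriv_eq_neg [FiniteDimensional ℝ E] [I.Boundaryless] [T2Space G]
    [MeasurableSpace G] [BorelSpace G] (μ : Measure G) [IsFiniteMeasureOnCompacts μ]
    [μ.IsMulLeftInvariant] {a f : G → ℝ} (ha : ContMDiff I 𝓘(ℝ, ℝ) 1 a)
    (hf : ContMDiff I 𝓘(ℝ, ℝ) 1 f) (hfc : HasCompactSupport f) (v : E) :
    ∫ x, a x * rightInvariantDeriv I f x v ∂μ = -∫ x, f x * rightInvariantDeriv I a x v ∂μ := by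
  have h := integral_rightInvariantDeriv_eq_zero μ (ha.mul hf) hfc.mul_left v
  have hX : ∀ {g : G → ℝ}, ContMDiff I 𝓘(ℝ, ℝ) 1 g →
      Continuous fun x => rightInvariantDeriv I g x v := fun hg =>
    (continuous_rightInvariantDeriv hg).clm_apply continuous_const
  have h1 : Integrable (fun x => a x * rightInvariantDeriv I f x v) μ :=
    (ha.continuous.mul (hX hf)).integrable_of_hasCompactSupport
      (((hasCompactSupport_rightInvariantDeriv hfc).comp_left
        (g := fun L : E →L[ℝ] ℝ => L v) rfl).mul_left)
  have h2 : Integrable (fun x => f x * rightInvariantDeriv I a x v) μ :=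
    (hf.continuous.mul (hX ha)).integrable_of_hasCompactSupport hfc.mul_right
  have h3 : ∀ x, rightInvariantDeriv I (a * f) x v =
      a x * rightInvariantDeriv I f x v + f x * rightInvariantDeriv I a x v :=
    fun x => rightInvariantDeriv_mul ha hf x v
  simp_rw [h3] at h
  rw [integral_add h1 h2] at h
  linarith

end Integrals

/-! ### The modular function along one-parameter subgroups -/

section ModularFunction

variable {E : Type*} [NormedAddCommGroup E] [NormedSpace ℝ E] [FiniteDimensional ℝ E]
  {H : Type*} [TopologicalSpace H] {I : ModelWithCorners ℝ E H} [I.Boundaryless]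
  {G : Type*} [TopologicalSpace G] [ChartedSpace H G] [Group G] [LieGroup I ∞ G]
  [T2Space G]

/-- The trace of `ad v = ⁅v, ·⁆`, computed as the sum of its diagonal coefficients in the basis
`e`. -/
def traceAd {n : ℕ} (e : Module.Basis (Fin n) ℝ (GroupLieAlgebra I G)) (v : GroupLieAlgebra I G) :
    ℝ := ∑ k, e.repr ⁅v, e k⁆ k

omit [FiniteDimensional ℝ E] [T2Space G] in
theorem hasMFDerivAt_lieAd_one :
    ∃ A : E →L[ℝ] E →L[ℝ] E, HasMFDerivAt I 𝓘(ℝ, E →L[ℝ] E) (lieAd I : G → E →L[ℝ] E) 1 A ∧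
      ∀ w v : E, A w v = Bracket.bracket (L := GroupLieAlgebra I G) (M := GroupLieAlgebra I G) w v :=
  have h := (contMDiff_lieAd (I := I) (G := G)).contMDiffAt.mdifferentiableAt (x := 1) (by simp)
  ⟨_, h.hasMFDerivAt, h.hasMFDerivAt.lieAd_one_apply⟩

variable [SecondCountableTopology G]
variable {v : GroupLieAlgebra I G} {γ : ℝ → G}

omit [I.Boundaryless] [T2Space G] [SecondCountableTopology G] in
theorem lieModularFunction_mul (g h : G) : lieModularFunction I (g * h) =
    lieModularFunction I g * lieModularFunction I h := by
  have : IsTopologicalGroup G := topologicalGroup_of_lieGroup I ∞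
  have : LocallyCompactSpace G := Manifold.locallyCompact_of_finiteDimensional I
  simp only [lieModularFunction, mul_inv_rev]
  rw [Measure.modularCharacterFun_map_mul, NNReal.coe_mul, mul_comm]

omit [I.Boundaryless] [T2Space G] [SecondCountableTopology G] in
theorem lieModularFunction_one : lieModularFunction I (1 : G) = 1 := by
  have : IsTopologicalGroup G := topologicalGroup_of_lieGroup I ∞
  have : LocallyCompactSpace G := Manifold.locallyCompact_of_finiteDimensional I
  simp only [lieModularFunction, inv_one]
  rw [Measure.modularCharacterFun_map_one, NNReal.coe_one]

omit [I.Boundaryless] [T2Space G] [SecondCountableTopology G] in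
theorem lieModularFunction_list_prod (l : List G) :
    lieModularFunction I l.prod = (l.map (lieModularFunction I)).prod := by
  induction l with
  | nil => exact lieModularFunction_one
  | cons g l ih => rw [List.prod_cons, lieModularFunction_mul, ih, List.map_cons, List.prod_cons]

omit [I.Boundaryless] [T2Space G] in
theorem integral_mul_right_eq_inv_lieModularFunction_mul [MeasurableSpace G] [BorelSpace G]
    (μ : Measure G) [μ.IsHaarMeasure] {f : G → ℝ} (hf : Continuous f) (g : G) :
    ∫ x, f (x * g) ∂μ = (lieModularFunction I g)⁻¹ * ∫ x, f x ∂μ := by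
  have hTG : IsTopologicalGroup G := topologicalGroup_of_lieGroup I ∞
  have hmap : μ.map (· * g) = ENNReal.ofReal (lieModularFunction I g)⁻¹ • μ := by
    ext A hA
    have hinv : lieModularFunction I g⁻¹ = (lieModularFunction I g)⁻¹ :=
      eq_inv_of_mul_eq_one_left (by
        rw [← lieModularFunction_mul, inv_mul_cancel, lieModularFunction_one])
    rw [Measure.map_apply (measurable_mul_const g) hA, Measure.smul_apply, smul_eq_mul, ← hinv,
      ← measure_image_mul_right (I := I) μ g⁻¹ hA, image_mul_right, inv_inv]
  rw [← integral_map (f := f) (measurable_mul_const g).aemeasurable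
    hf.aestronglyMeasurable, hmap, integral_smul_measure, ENNReal.toReal_ofReal, smul_eq_mul]
  exact (inv_pos.2 (lieModularFunction_pos I g)).le

omit [T2Space G] [SecondCountableTopology G] in
/-- The coordinates of `lieAd I x v` in a basis are `C¹` functions of `x`, and their derivatives at
the identity are the coordinates of the brackets with `v`. -/
theorem exists_contMDiff_coeff_lieAd {n : ℕ} (e : Module.Basis (Fin n) ℝ E) (v : E) :
    ∃ a : Fin n → G → ℝ, (∀ k, ContMDiff I 𝓘(ℝ, ℝ) 1 (a k)) ∧
      (∀ x, ∑ k, a k x • e k = lieAd I x v) ∧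
      ∀ k (w : E), rightInvariantDeriv I (a k) 1 w = e.repr
        (Bracket.bracket (L := GroupLieAlgebra I G) (M := GroupLieAlgebra I G) w v : E) k := by
  let ℓ : Fin n → (E →L[ℝ] E) →L[ℝ] ℝ := fun k =>
    (LinearMap.toContinuousLinearMap (e.coord k)) ∘L (ContinuousLinearMap.apply ℝ E v)
  refine ⟨fun k x => ℓ k (lieAd I x), fun k => ?_, fun x => ?_, fun k w => ?_⟩
  · exact (ℓ k).contMDiff.comp contMDiff_lieAd
  · simp [ℓ, e.sum_repr]
  · obtain ⟨A, hA, hbr⟩ := hasMFDerivAt_lieAd_one (I := I) (G := G)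
    have h1 : HasMFDerivAt I 𝓘(ℝ, ℝ) (fun x : G => ℓ k (lieAd I (x * 1))) 1 (ℓ k ∘L A) :=
      (HasMFDerivAt.comp (1 : G) (ℓ k).hasMFDerivAt hA).congr_of_eventuallyEq
        (Eventually.of_forall fun x => by simp)
    rw [← hbr w v]
    exact DFunLike.congr_fun (F := E →L[ℝ] ℝ) h1.mfderiv w

/-- The reciprocal of the modular function grows at the identity at rate `tr (ad v)` along the
one-parameter subgroup of `v`. -/
theorem IsMIntegralCurve.hasDerivAt_lieModularFunction_inv {n : ℕ}
    (e : Module.Basis (Fin n) ℝ (GroupLieAlgebra I G))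
    (hγ : IsMIntegralCurve γ (mulInvariantVectorField v)) (h0 : γ 0 = 1) :
    HasDerivAt (fun t => (lieModularFunction I (γ t))⁻¹) (traceAd e v) 0 := by
  have hTG : IsTopologicalGroup G := topologicalGroup_of_lieGroup I ∞
  have hc : CompleteSpace E := FiniteDimensional.complete ℝ E
  have hlc : LocallyCompactSpace G := Manifold.locallyCompact_of_finiteDimensional I
  borelize G
  let μ : Measure G := Measure.haar
  obtain ⟨a, ha, hsum, hbr⟩ := exists_contMDiff_coeff_lieAd (I := I) (G := G) (E := E) e v
  -- `h` is the divergence-like term produced by the integration by parts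
  set h : G → ℝ := fun x => ∑ k, rightInvariantDeriv I (a k) x (e k : E) with hh
  have hhc : Continuous h := continuous_finsetSum _ fun k _ =>
    (continuous_rightInvariantDeriv (ha k)).clm_apply continuous_const
  have hh1 : h 1 = -traceAd e v := by
    rw [traceAd, ← Finset.sum_neg_distrib]
    refine Finset.sum_congr rfl fun k _ => ?_
    have hswap : ⁅e k, v⁆ = -⁅v, e k⁆ := mlieBracket_swap_apply
    refine (hbr k (e k)).trans ((congrArg (fun u => e.repr u k) hswap).trans ?_)
    simp
  have hint : ∀ f : G → ℝ, ContMDiff I 𝓘(ℝ, ℝ) 1 f → HasCompactSupport f →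
      ∫ x, leftInvariantDeriv I f x (v : E) ∂μ = -∫ x, f x * h x ∂μ := by
    intro f hf hfc
    have hX : ∀ k {g : G → ℝ}, ContMDiff I 𝓘(ℝ, ℝ) 1 g →
        Continuous fun x => rightInvariantDeriv I g x (e k : E) := fun k g hg =>
      (continuous_rightInvariantDeriv hg).clm_apply continuous_const
    have h1 : ∀ x, leftInvariantDeriv I f x (v : E) =
        ∑ k, a k x * rightInvariantDeriv I f x (e k : E) := by
      intro x
      have hlin : ∀ (L : E →L[ℝ] ℝ) (r : Fin n → ℝ) (u : Fin n → E),
          L (∑ k, r k • u k) = ∑ k, r k * L (u k) := fun L r u => by simp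
      exact (leftInvariantDeriv_eq_rightInvariantDeriv_lieAd hf x v).trans
        ((congrArg _ (hsum x).symm).trans (hlin _ _ _))
    have h2 : ∀ k, Integrable (fun x => a k x * rightInvariantDeriv I f x (e k : E)) μ := fun k =>
      ((ha k).continuous.mul (hX k hf)).integrable_of_hasCompactSupport
        (((hasCompactSupport_rightInvariantDeriv hfc).comp_left
          (g := fun L : E →L[ℝ] ℝ => L (e k : E)) rfl).mul_left)
    have h3 : ∀ k, Integrable (fun x => f x * rightInvariantDeriv I (a k) x (e k : E)) μ := fun k =>
      (hf.continuous.mul (hX k (ha k))).integrable_of_hasCompactSupport hfc.mul_right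
    simp_rw [h1, hh, Finset.mul_sum]
    rw [integral_finsetSum _ fun k _ => h2 k, integral_finsetSum _ fun k _ => h3 k,
      ← Finset.sum_neg_distrib]
    exact Finset.sum_congr rfl fun k _ => integral_mul_rightInvariantDeriv_eq_neg μ (ha k) hf hfc _
  have key : ∀ f : G → ℝ, ContMDiff I 𝓘(ℝ, ℝ) 1 f → HasCompactSupport f →
      HasDerivAt (fun t => (lieModularFunction I (γ t))⁻¹ * ∫ x, f x ∂μ) (-∫ x, f x * h x ∂μ) 0 := by
    intro f hf hfc
    rw [← hint f hf hfc]
    refine (hγ.hasDerivAt_integral_mul μ h0 hf hfc).congr_of_eventuallyEq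
      (Eventually.of_forall fun t => ?_)
    exact (integral_mul_right_eq_inv_lieModularFunction_mul μ hf.continuous (γ t)).symm
  have hpos : ∀ f : SmoothBumpFunction I (1 : G), 0 < ∫ x, f x ∂μ := fun f =>
    f.continuous.integral_pos_of_hasCompactSupport_nonneg_nonzero f.hasCompactSupport
      (fun _ => f.nonneg) (x := 1) (by rw [f.eq_one]; exact one_ne_zero)
  have hsm : ∀ f : SmoothBumpFunction I (1 : G), ContMDiff I 𝓘(ℝ, ℝ) 1 f := fun f =>
    f.contMDiff.of_le (by simp)
  -- a single bump function, which has nonzero integral, shows differentiability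
  obtain ⟨d, hd⟩ : ∃ d, HasDerivAt (fun t => (lieModularFunction I (γ t))⁻¹) d 0 := by
    obtain ⟨f, -, -⟩ := (SmoothBumpFunction.nhds_basis_tsupport (I := I) (1 : G)).mem_iff.1 univ_mem
    have h1 := (key f (hsm f) f.hasCompactSupport).mul_const (∫ x, f x ∂μ)⁻¹
    refine ⟨_, h1.congr_of_eventuallyEq (Eventually.of_forall fun t => ?_)⟩
    simp only
    rw [mul_inv_cancel_right₀ (hpos f).ne']
  have hzero : ∀ f : SmoothBumpFunction I (1 : G), ∫ x, f x * (d + h x) ∂μ = 0 := by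
    intro f
    have h1 := (hd.mul_const (∫ x, f x ∂μ)).unique (key f (hsm f) f.hasCompactSupport)
    have h2 : Integrable (fun x => f x * d) μ :=
      (f.continuous.mul continuous_const).integrable_of_hasCompactSupport
        f.hasCompactSupport.mul_right
    have h3 : Integrable (fun x => f x * h x) μ :=
      (f.continuous.mul hhc).integrable_of_hasCompactSupport f.hasCompactSupport.mul_right
    simp_rw [mul_add]
    rw [integral_add h2 h3, integral_mul_const]
    linarith
  suffices hdh : d + h 1 = 0 by
    have : d = traceAd e v := by linarith
    rwa [← this]
  -- otherwise a bump function supported where `d + h` keeps its sign has nonzero integral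
  by_contra hne
  set q : G → ℝ := fun x => (d + h x) * (d + h 1) with hq
  have hqc : Continuous q := (continuous_const.add hhc).mul continuous_const
  have hq1 : 0 < q 1 := mul_self_pos.2 hne
  obtain ⟨f, -, hf⟩ := (SmoothBumpFunction.nhds_basis_tsupport (I := I) (1 : G)).mem_iff.1
    (hqc.continuousAt.eventually (lt_mem_nhds hq1))
  have h1 : 0 < ∫ x, f x * q x ∂μ := by
    refine (f.continuous.mul hqc).integral_pos_of_hasCompactSupport_nonneg_nonzero
      f.hasCompactSupport.mul_right (fun x => ?_) (x := 1) ?_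
    · by_cases hx : x ∈ tsupport f
      · exact mul_nonneg f.nonneg (le_of_lt (hf hx))
      · simp [image_eq_zero_of_notMem_tsupport hx]
    · rw [f.eq_one, one_mul]; exact hq1.ne'
  refine h1.ne' ?_
  simp_rw [hq, ← mul_assoc]
  rw [integral_mul_const, hzero f, zero_mul]

/-- The modular function on the image of the exponential map. -/
theorem lieModularFunction_lieExp {n : ℕ}
    (e : Module.Basis (Fin n) ℝ (GroupLieAlgebra I G)) (v : GroupLieAlgebra I G) :
    lieModularFunction I (lieExp v : G) = Real.exp (-traceAd e v) := by
  have hc : CompleteSpace E := FiniteDimensional.complete ℝ E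
  obtain ⟨γ, h0, hγ⟩ := exists_integralCurve_mulInvariantVectorField (I := I) (G := G) v
  rw [lieExp_eq v h0 hγ]
  set d := traceAd e v
  set ℓ : ℝ → ℝ := fun t => (lieModularFunction I (γ t))⁻¹ with hℓ
  have hd0 : HasDerivAt ℓ d 0 := hγ.hasDerivAt_lieModularFunction_inv e h0
  have hadd : ∀ s t, ℓ (s + t) = ℓ s * ℓ t := fun s t => by
    simp only [hℓ]
    rw [hγ.map_add_of_map_zero h0, lieModularFunction_mul, mul_inv]
  have hd : ∀ t, HasDerivAt ℓ (ℓ t * d) t := fun t => by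
    have h1 : HasDerivAt (fun s => s - t) 1 t := (hasDerivAt_id t).sub_const t
    rw [← sub_self t] at hd0
    have h2 := (HasDerivAt.comp t (h₂ := ℓ) (h := fun s => s - t) hd0 h1).const_mul (ℓ t)
    rw [mul_one] at h2
    refine h2.congr_of_eventuallyEq (Eventually.of_forall fun s => ?_)
    simp only [Function.comp_apply]
    rw [← hadd, add_sub_cancel]
  have hd' : ∀ t, HasDerivAt (fun s => ℓ s * Real.exp (-(d * s))) 0 t := fun t => by
    have h1 : HasDerivAt (fun s : ℝ => -(d * s)) (-(d * 1)) t :=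
      ((hasDerivAt_id t).const_mul d).neg
    exact ((hd t).mul h1.exp).congr_deriv (by ring)
  have hconst := is_const_of_deriv_eq_zero (fun t => (hd' t).differentiableAt)
    (fun t => (hd' t).deriv) 1 0
  simp only [hℓ, h0, lieModularFunction_one, mul_zero, neg_zero, Real.exp_zero, mul_one,
    inv_one] at hconst
  rwa [inv_mul_eq_one₀ (lieModularFunction_pos I _).ne'] at hconst

omit [FiniteDimensional ℝ E] [T2Space G] [SecondCountableTopology G] in
/-- The trace of `ad v` in terms of structure constants. -/
theorem traceAd_eq_sum_structureConstants {n : ℕ}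
    (e : Module.Basis (Fin n) ℝ (GroupLieAlgebra I G)) {c : Fin n → Fin n → Fin n → ℝ}
    (hc : ∀ i j, ⁅e i, e j⁆ = ∑ k, c i j k • e k) (v : GroupLieAlgebra I G) :
    traceAd e v = ∑ i, (∑ j, c i j j) * e.repr v i := by
  obtain ⟨A, -, hA⟩ := hasMFDerivAt_lieAd_one (I := I) (G := G)
  have h1 : ∀ j, ⁅v, e j⁆ = ∑ i, e.repr v i • ⁅e i, e j⁆ := by
    intro j
    have h2 : ∑ i, e.repr v i • (e i : E) = (v : E) := e.sum_repr v
    have h3 : A v (e j : E) = ∑ i, e.repr v i • A (e i : E) (e j : E) := by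
      have hlin : ∀ (r : Fin n → ℝ) (u : Fin n → E) (w : E),
          A (∑ i, r i • u i) w = ∑ i, r i • A (u i) w := fun r u w => by simp
      exact (congrArg (fun w : E => A w (e j : E)) h2.symm).trans (hlin _ _ _)
    refine (hA v (e j)).symm.trans (h3.trans ?_)
    exact Finset.sum_congr rfl fun i _ => congrArg (fun w : E => e.repr v i • w) (hA (e i) (e j))
  have h4 : ∀ j, e.repr ⁅v, e j⁆ j = ∑ i, e.repr v i * c i j j := by
    intro j
    rw [h1]
    simp only [hc, map_sum, map_smul, Finsupp.coe_finsetSum, Finset.sum_apply, Finsupp.smul_apply,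
      smul_eq_mul, Module.Basis.repr_self]
    simp [Finsupp.single_apply]
  simp_rw [traceAd, h4, Finset.sum_mul]
  rw [Finset.sum_comm]
  exact Finset.sum_congr rfl fun i _ => Finset.sum_congr rfl fun j _ => mul_comm _ _

omit [FiniteDimensional ℝ E] [I.Boundaryless] [LieGroup I ∞ G] [T2Space G]
  [SecondCountableTopology G] in
theorem core_inner_basis_eq_repr {n : ℕ} (ip : InnerProductSpace.Core ℝ (GroupLieAlgebra I G))
    (e : Module.Basis (Fin n) ℝ (GroupLieAlgebra I G))
    (he : ∀ i j, ip.inner (e i) (e j) = if i = j then 1 else 0) (v : GroupLieAlgebra I G)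
    (k : Fin n) : ip.inner (e k) v = e.repr v k := by
  let L : GroupLieAlgebra I G →ₗ[ℝ] ℝ :=
    { toFun := fun x => ip.inner (e k) x
      map_add' := fun x y => by
        rw [← ip.conj_inner_symm, ip.add_left, map_add, ip.conj_inner_symm, ip.conj_inner_symm]
      map_smul' := fun r x => by
        rw [← ip.conj_inner_symm, ip.smul_left, map_mul, ip.conj_inner_symm]
        simp }
  have h : L = e.coord k := e.ext fun i => by
    simp [L, he, Finsupp.single_apply, eq_comm]
  exact DFunLike.congr_fun h v

end ModularFunction

end

theorem mainTheorem7
    {E : Type*} [NormedAddCommGroup E] [NormedSpace ℝ E] [FiniteDimensional ℝ E]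
    {H : Type*} [TopologicalSpace H] (I : ModelWithCorners ℝ E H) [I.Boundaryless]
    {G : Type*} [TopologicalSpace G] [ChartedSpace H G] [Group G] [LieGroup I ∞ G]
    [T2Space G] [SecondCountableTopology G] [ConnectedSpace G]
    (n : ℕ)
    -- an inner product on the Lie algebra and an orthonormal basis for it
    (ip : InnerProductSpace.Core ℝ (GroupLieAlgebra I G))
    (e : Module.Basis (Fin n) ℝ (GroupLieAlgebra I G))
    (he : ∀ i j, ip.inner (e i) (e j) = if i = j then 1 else 0)
    -- the structure constants in this basis
    (c : Fin n → Fin n → Fin n → ℝ)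
    (hc : ∀ i j, ⁅e i, e j⁆ = ∑ k, c i j k • e k)
    (a : Fin n → ℝ) (ha : ∀ i, a i = ∑ j, c i j j)
    -- the Lie algebra elements of the discretization and their coordinates
    (m : ℕ) (hm : 1 ≤ m) (v : Fin (m - 1) → GroupLieAlgebra I G)
    (b : Fin (m - 1) → Fin n → ℝ) (hb : ∀ i k, b i k = ip.inner (e k) (v i)) :
    lieModularFunction I (List.ofFn fun i => lieExp (v i)).prod
      = Real.exp (-∑ i, a ⬝ᵥ b i) := by
  have h : ∀ i, lieModularFunction I (lieExp (v i) : G) = Real.exp (-(a ⬝ᵥ b i)) := by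
    intro i
    rw [lieModularFunction_lieExp e, traceAd_eq_sum_structureConstants e hc]
    simp only [dotProduct, ha, hb, core_inner_basis_eq_repr ip e he]
  rw [lieModularFunction_list_prod, List.map_ofFn, List.prod_ofFn, ← Finset.sum_neg_distrib,
    Real.exp_sum]
  exact Finset.prod_congr rfl fun i _ => h i
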